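/- Call a group virtually free if it has a free subgroup of finite index (no finite generation is assumed). Let $\Gamma$ be a virtually free group and let $(\gamma_1,\ldots,\gamma_m)$ be an independent $m$-tuple of elements of $\Gamma$, that is, each $\gamma_i$ has infinite order and, whenever $1\le i<j\le m$, no non-zero power of $\gamma_i$ is conjugate in $\Gamma$ to a non-zero power of $\gamma_j$. Then there is a positive integer $\kappa$ such that, for every $m$-tuple $(e_1,\ldots,e_m)$ of positive integers, there are a finite group $Q$ and a homomorphism $q:\Gamma\to Q$ such that: 1. the order of $q(\gamma_i)$ is $\kappa e_i$ for $i=1,\ldots,m$; and 2. $\langle q(\gamma_i)\rangle\cap\langle q(\gamma_j)\rangle=1$ whenever $i\neq j$. -/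

import Mathlib

/-- A group is virtually free if it has a free subgroup of finite index.
No finite generation is required. -/
def IsVirtuallyFree (Γ : Type*) [Group Γ] : Prop :=
  ∃ Λ : Subgroup Γ, Λ.FiniteIndex ∧ IsFreeGroup Λ

/-- Two elements of infinite order are independent if no non-zero power of the first is conjugate
to a non-zero power of the second. -/
def AreIndependent {Γ : Type*} [Group Γ] (x y : Γ) : Prop :=
  ¬ IsOfFinOrder x ∧ ¬ IsOfFinOrder y ∧
    ∀ a b : ℤ, a ≠ 0 → b ≠ 0 → ¬ IsConj (x ^ a) (y ^ b)

/-- A tuple of elements of infinite order is independent if its entries are pairwise independent.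
(The first clause matters only for a tuple of length one.) -/
def IsIndependentTuple {Γ : Type*} [Group Γ] {m : ℕ} (γ : Fin m → Γ) : Prop :=
  (∀ i, ¬ IsOfFinOrder (γ i)) ∧ ∀ i j, i < j → AreIndependent (γ i) (γ j)

/-! It suffices to treat one `γ i` at a time: some finite-index normal subgroup has an integral
character that kills every conjugate of a power of `γ j`, `j ≠ i`, lying in it, but not some
conjugate of a power of `γ i` (`IsVirtuallyFree.exists_normal_character`). Reducing this character
modulo suitable integers prescribes the order of `γ i` while the other `γ j` keep bounded order
(`exists_quotient_orderOf`). The resulting kernels are intersected over `i`, with `κ` divisible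
enough to absorb the bounded parts.

The character comes from covers of graphs, over a free group. Up to conjugacy the elements are
cyclically reduced, hence given by periodic lines; let `a` be the line to be detected. A finite
Cayley graph in which the lines are separated carries integer edge weights that vanish along the
line of `a` through `1` but have nonzero sum along all closed lines of the other words, since each
of these leaves the line of `a` (`PeriodicWord.exists_weights`). Modulo a large prime `p` the
weights define a cyclic `p`-sheeted cover. There the line of `a` stays on its sheet, whereas each of
the others closes up only after winding through all sheets. Now weight one edge of `a` by `+1` on
one sheet and `-1` on another: every fibre has total zero, so the other lines have sum zero, while
the lift of `a` to the first sheet does not (`PeriodicWord.exists_cocycle`). This sum is the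
character. -/

namespace FreeGroup

variable {S X A B : Type*} [AddCommGroup A] [AddCommGroup B]

/-! ### Skew products and cocycles over Schreier graphs. -/

/-- The action of the free group on `X × A` obtained from an action on `X` and `A`-valued weights
on the edges of its Schreier graph. -/
def skewAction (ρ : FreeGroup S →* Equiv.Perm X) (ω : S → X → A) :
    FreeGroup S →* Equiv.Perm (X × A) :=
  lift fun s =>
    { toFun := fun p => (ρ (of s) p.1, p.2 + ω s p.1)
      invFun := fun p => ((ρ (of s))⁻¹ p.1, p.2 - ω s ((ρ (of s))⁻¹ p.1))
      left_inv := fun p => by simp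
      right_inv := fun p => by simp }

/-- The total weight of the path which starts at `x` and is labelled by `w`. -/
def cocycle (ρ : FreeGroup S →* Equiv.Perm X) (ω : S → X → A) (w : FreeGroup S) (x : X) : A :=
  (skewAction ρ ω w (x, 0)).2

variable (ρ : FreeGroup S →* Equiv.Perm X) (ω : S → X → A)

theorem skewAction_of (s : S) (p : X × A) :
    skewAction ρ ω (of s) p = (ρ (of s) p.1, p.2 + ω s p.1) := by
  simp [skewAction]

/-- Translations of the fibre commute with the action, because a generator adds a weight depending
only on the base point. -/
theorem skewAction_apply (w : FreeGroup S) (x : X) (a : A) :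
    skewAction ρ ω w (x, a) = (ρ w x, a + cocycle ρ ω w x) := by
  have key : ∀ (x : X) (a b : A), skewAction ρ ω w (x, a + b) =
      (ρ w x, a + (skewAction ρ ω w (x, b)).2) := by
    induction w using FreeGroup.induction_on with
    | C1 => intro x a b; simp
    | of s => intro x a b; simp [skewAction_of, add_assoc]
    | inv_of s ih =>
      intro x a b
      rw [_root_.map_inv, Equiv.Perm.inv_eq_iff_eq]
      set q := (skewAction ρ ω (of s))⁻¹ (x, b) with hq
      have hq' : skewAction ρ ω (of s) q = (x, b) := by simp [hq]
      rw [skewAction_of] at hq' ⊢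
      simp only [Prod.mk.injEq] at hq' ⊢
      refine ⟨by simp, ?_⟩
      have : (ρ (of s)⁻¹) x = q.1 := by rw [← hq'.1]; simp
      rw [this, add_assoc, hq'.2]
    | mul u v hu hv =>
      intro x a b
      rw [_root_.map_mul, Equiv.Perm.mul_apply, hv, hu, _root_.map_mul, Equiv.Perm.mul_apply,
        Equiv.Perm.mul_apply]
      congr 2
      have h0 := hv x 0 b
      rw [zero_add, zero_add] at h0
      rw [h0]
  simpa [cocycle] using key x a 0

@[simp] theorem cocycle_one (x : X) : cocycle ρ ω 1 x = 0 := by simp [cocycle]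

@[simp] theorem cocycle_of (s : S) (x : X) : cocycle ρ ω (of s) x = ω s x := by
  simp [cocycle, skewAction_of]

theorem cocycle_mul (u v : FreeGroup S) (x : X) :
    cocycle ρ ω (u * v) x = cocycle ρ ω v x + cocycle ρ ω u (ρ v x) := by
  have h : skewAction ρ ω (u * v) (x, 0) = skewAction ρ ω u (skewAction ρ ω v (x, 0)) := by
    rw [_root_.map_mul, Equiv.Perm.mul_apply]
  rw [skewAction_apply, skewAction_apply, skewAction_apply] at h
  simpa using congrArg Prod.snd h

theorem cocycle_inv (u : FreeGroup S) (x : X) :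
    cocycle ρ ω u⁻¹ x = -cocycle ρ ω u ((ρ u)⁻¹ x) := by
  have h := cocycle_mul ρ ω u u⁻¹ x
  rw [mul_inv_cancel, cocycle_one, _root_.map_inv] at h
  exact eq_neg_of_add_eq_zero_left h.symm

theorem cocycle_pow {u : FreeGroup S} {x : X} (hu : ρ u x = x) (n : ℕ) :
    cocycle ρ ω (u ^ n) x = n • cocycle ρ ω u x := by
  induction n with
  | zero => simp
  | succ n ih => rw [pow_succ, cocycle_mul, hu, ih, succ_nsmul']

theorem cocycle_zpow {u : FreeGroup S} {x : X} (hu : ρ u x = x) (n : ℤ) :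
    cocycle ρ ω (u ^ n) x = n • cocycle ρ ω u x := by
  have hi (n : ℕ) : ρ (u ^ n) x = x := by
    induction n with
    | zero => simp
    | succ n ih => rw [pow_succ, _root_.map_mul, Equiv.Perm.mul_apply, hu, ih]
  cases n with
  | ofNat n => simpa using cocycle_pow ρ ω hu n
  | negSucc n =>
    rw [zpow_negSucc, cocycle_inv, negSucc_zsmul]
    have : (ρ (u ^ (n + 1)))⁻¹ x = x := by rw [Equiv.Perm.inv_eq_iff_eq, hi]
    rw [this, cocycle_pow ρ ω hu]

/-- The weights along `t⁻¹` and back cancel, as `u` fixes the point in between; only the base point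
of the loop moves. -/
theorem cocycle_conj {u : FreeGroup S} (hu : ρ u = 1) (t : FreeGroup S) (x : X) :
    cocycle ρ ω (t * u * t⁻¹) x = cocycle ρ ω u (ρ t⁻¹ x) := by
  rw [cocycle_mul, cocycle_mul, cocycle_inv, hu]
  simp

theorem cocycle_map (f : A →+ B) (w : FreeGroup S) (x : X) :
    cocycle ρ (fun s y => f (ω s y)) w x = f (cocycle ρ ω w x) := by
  induction w using FreeGroup.induction_on generalizing x with
  | C1 => simp
  | of s => simp
  | inv_of s ih => rw [cocycle_inv, cocycle_inv, ih, map_neg]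
  | mul u v hu hv => rw [cocycle_mul, cocycle_mul, hu, hv, map_add]

/-- If the weights of an extension by a finite group sum to zero over each fibre,
so do the weights of all paths. -/
theorem sum_cocycle_skewAction [Fintype B] (η : S → X → B) (θ : S → X × B → A)
    (hθ : ∀ s y, ∑ b, θ s (y, b) = 0) (w : FreeGroup S) (x : X) :
    ∑ b, cocycle (skewAction ρ η) θ w (x, b) = 0 := by
  induction w using FreeGroup.induction_on generalizing x with
  | C1 => simp
  | of s => simpa using hθ s x
  | inv_of s ih =>
    simp_rw [cocycle_inv, Finset.sum_neg_distrib, ← _root_.map_inv, skewAction_apply]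
    rw [neg_eq_zero, ← ih (ρ (of s)⁻¹ x)]
    exact Fintype.sum_equiv (Equiv.addRight _) _ _ fun b => rfl
  | mul u v hu hv =>
    simp_rw [cocycle_mul, Finset.sum_add_distrib, skewAction_apply]
    rw [hv, zero_add, ← hu (ρ v x)]
    exact Fintype.sum_equiv (Equiv.addRight _) _ _ fun b => rfl

/-! ### Residual finiteness of free groups. -/

/-- The opposite letter. -/
def invLetter (x : S × Bool) : S × Bool := (x.1, !x.2)

@[simp] theorem invLetter_invLetter (x : S × Bool) : invLetter (invLetter x) = x := by
  simp [invLetter]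

theorem mk_invLetter (x : S × Bool) : mk [invLetter x] = (mk [x])⁻¹ := by
  simp [invLetter, inv_mk, invRev]

theorem mk_true (s : S) : mk [(s, true)] = of s := rfl

theorem mk_false (s : S) : mk [(s, false)] = (of s)⁻¹ := mk_invLetter (s, true)

/-- In a finite set, the domain and range of a partial injection have complements of equal size. -/
theorem exists_perm_of_functional {α : Type*} [Finite α] (R : α → α → Prop)
    (h₁ : ∀ x y z, R x y → R x z → y = z) (h₂ : ∀ x y z, R x z → R y z → x = y) :
    ∃ σ : Equiv.Perm α, ∀ x y, R x y → σ x = y := by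
  classical
  let e : {x // ∃ y, R x y} ≃ {y // ∃ x, R x y} :=
    { toFun := fun x => ⟨x.2.choose, x.1, x.2.choose_spec⟩
      invFun := fun y => ⟨y.2.choose, y.1, y.2.choose_spec⟩
      left_inv := fun x => Subtype.ext
        (h₂ _ _ _ (Exists.choose_spec (p := fun z => R z _) _) x.2.choose_spec)
      right_inv := fun y => Subtype.ext
        (h₁ _ _ _ (Exists.choose_spec (p := fun z => R _ z) _) y.2.choose_spec) }
  refine ⟨e.extendSubtype, fun x y hxy => ?_⟩
  rw [e.extendSubtype_apply_of_mem x ⟨y, hxy⟩]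
  exact h₁ _ _ _ (Exists.choose_spec (p := fun z => R x z) _) hxy

/-- A nontrivial element of a free group acts nontrivially on some finite set. -/
theorem exists_perm_ne_one {w : FreeGroup S} (hw : w ≠ 1) :
    ∃ (n : ℕ) (ρ : FreeGroup S →* Equiv.Perm (Fin n)), ρ w ≠ 1 := by
  classical
  set L := w.toWord with hL
  have hne : L ≠ [] := by simpa [hL] using hw
  have hred : IsReduced L := isReduced_toWord
  have hch : ∀ (i : ℕ) (h : i + 1 < L.length), L[i].1 = L[i + 1].1 → L[i].2 = L[i + 1].2 :=
    List.isChain_iff_getElem.1 hred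
  set n := L.length
  -- The letter at index `i` moves `i + 1` to `i`.
  let R (s : S) (x y : Fin (n + 1)) : Prop :=
    (∃ h : y.1 < n, x.1 = y.1 + 1 ∧ L[y.1] = (s, true)) ∨
    (∃ h : x.1 < n, y.1 = x.1 + 1 ∧ L[x.1] = (s, false))
  have hR (s : S) : ∃ σ : Equiv.Perm (Fin (n + 1)), ∀ x y, R s x y → σ x = y := by
    apply exists_perm_of_functional
    · rintro x y z (⟨h, hx, hl⟩ | ⟨h, hx, hl⟩) (⟨h', hx', hl'⟩ | ⟨h', hx', hl'⟩)
      · ext; omega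
      · have := hch y.1 (by omega)
        simp only [hl, ← hx, hl'] at this
        simp at this
      · have := hch z.1 (by omega)
        simp only [hl', ← hx', hl] at this
        simp at this
      · ext; omega
    · rintro x y z (⟨h, hx, hl⟩ | ⟨h, hx, hl⟩) (⟨h', hx', hl'⟩ | ⟨h', hx', hl'⟩)
      · ext; omega
      · have := hch y.1 (by omega)
        simp only [hl', ← hx', hl] at this
        simp at this
      · have := hch x.1 (by omega)
        simp only [hl, ← hx, hl'] at this
        simp at this
      · ext; omega
  choose σ hσ using hR
  refine ⟨n + 1, lift σ, fun h => ?_⟩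
  -- Suffixes act first, so the whole word carries the last point to `0`, a different point because
  -- the word is nonempty.
  have hpath : ∀ i (hi : i ≤ n), lift σ (mk (L.drop (n - i))) (Fin.last n) =
      Fin.ofNat (n + 1) (n - i) := by
    intro i
    induction i with
    | zero => intro _; simp [n, ← one_eq_mk]
    | succ i ih =>
      intro hi
      have hlt : n - (i + 1) < n := by omega
      have hsucc : n - (i + 1) + 1 = n - i := by omega
      rw [List.drop_eq_getElem_cons hlt, hsucc, ← List.singleton_append, ← mul_mk, _root_.map_mul,
        Equiv.Perm.mul_apply, ih (by omega)]
      have hv (j : ℕ) : (Fin.ofNat (n + 1) (n - j)).1 = n - j := Nat.mod_eq_of_lt (by omega)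
      rcases hl : L[n - (i + 1)] with ⟨s, b⟩
      cases b
      · rw [mk_false, _root_.map_inv, lift_apply_of, Equiv.Perm.inv_eq_iff_eq]
        exact (hσ s _ _ (Or.inr (by simp only [hv]; exact ⟨hlt, hsucc.symm, hl⟩))).symm
      · rw [mk_true, lift_apply_of]
        exact hσ s _ _ (Or.inl (by simp only [hv]; exact ⟨hlt, hsucc.symm, hl⟩))
  have h1 := hpath n le_rfl
  rw [Nat.sub_self, List.drop_zero, hL, mk_toWord, h] at h1
  have h2 : n = 0 := by simpa using congrArg Fin.val h1
  exact hne (List.length_eq_zero_iff.1 h2)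

/-- A finite set of elements of a free group embeds into a finite quotient. -/
theorem exists_normal_injOn (T : Set (FreeGroup S)) (hT : T.Finite) :
    ∃ N : Subgroup (FreeGroup S), N.Normal ∧ N.FiniteIndex ∧
      ∀ x ∈ T, ∀ y ∈ T, x⁻¹ * y ∈ N → x = y := by
  classical
  have h : ∀ w : FreeGroup S, ∃ N : Subgroup (FreeGroup S), N.Normal ∧ N.FiniteIndex ∧
      (w ∈ N → w = 1) := by
    intro w
    by_cases hw : w = 1
    · exact ⟨⊤, inferInstance, inferInstance, fun _ => hw⟩
    · obtain ⟨n, ρ, hρ⟩ := exists_perm_ne_one hw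
      exact ⟨ρ.ker, inferInstance, inferInstance, fun h => absurd h hρ⟩
  choose N hN hfin hw using h
  have : Finite (T ×ˢ T : Set _) := hT.prod hT
  refine ⟨⨅ p : (T ×ˢ T : Set _), N (p.1.1⁻¹ * p.1.2), Subgroup.normal_iInf_normal fun p => hN _,
    Subgroup.finiteIndex_iInf fun p => hfin _, fun x hx y hy hxy => ?_⟩
  have := hw _ (Subgroup.mem_iInf.1 hxy ⟨(x, y), hx, hy⟩)
  exact (inv_mul_eq_one.1 this)

end FreeGroup

/-! ### Periodic words and their lines. -/

namespace FreeGroup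

variable {S : Type*}

/-- The vertices of the bi-infinite path labelled by `a`, starting from `1` at time `0`. -/
def linePos (a : ℤ → S × Bool) : ℤ → FreeGroup S
  | Int.ofNat n => Nat.rec 1 (fun k p => mk [a k] * p) n
  | Int.negSucc n => Nat.rec (mk [a (-1)])⁻¹ (fun k p => (mk [a (Int.negSucc (k + 1))])⁻¹ * p) n

theorem linePos_succ (a : ℤ → S × Bool) (k : ℤ) :
    linePos a (k + 1) = mk [a k] * linePos a k := by
  match k with
  | Int.ofNat n => rfl
  | Int.negSucc 0 => exact (mul_inv_cancel (mk [a (-1)])).symm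
  | Int.negSucc (n + 1) =>
    have h : linePos a (Int.negSucc (n + 1)) =
      (mk [a (Int.negSucc (n + 1))])⁻¹ * linePos a (Int.negSucc n) := rfl
    rw [h, mul_inv_cancel_left]
    congr 1

/-- A periodic reduced bi-infinite word. -/
structure PeriodicWord (S : Type*) where ofLetter ::
  /-- The letter at each time. -/
  letter : ℤ → S × Bool
  /-- A period of the word. -/
  period : ℕ
  period_pos : 0 < period
  periodic : ∀ k, letter (k + period) = letter k
  reduced : ∀ k, letter (k + 1) ≠ invLetter (letter k)

namespace PeriodicWord

variable (a b : PeriodicWord S)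

/-- The vertices of the line labelled by a periodic word. -/
def pos : ℤ → FreeGroup S := linePos a.letter

/-- The element which translates the line by one period. -/
def elt : FreeGroup S := a.pos a.period

@[simp] theorem pos_zero : a.pos 0 = 1 := rfl

theorem pos_succ (k : ℤ) : a.pos (k + 1) = mk [a.letter k] * a.pos k := linePos_succ _ _

theorem pos_add_period (k : ℤ) : a.pos (k + a.period) = a.pos k * a.elt := by
  induction k using Int.induction_on with
  | zero => simp [elt]
  | succ k ih => rw [add_right_comm, pos_succ, ih, pos_succ, a.periodic, mul_assoc]
  | pred k ih =>
    have h := a.pos_succ (-k - 1 + a.period)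
    have h' := a.pos_succ (-k - 1)
    rw [sub_add_cancel] at h'
    rw [add_right_comm, sub_add_cancel, ih, a.periodic, h', mul_assoc] at h
    exact (mul_left_cancel h).symm

theorem pos_add_mul_period (k : ℤ) (n : ℕ) :
    a.pos (k + n * a.period) = a.pos k * a.elt ^ n := by
  induction n with
  | zero => simp
  | succ n ih =>
    have : k + ((n + 1 : ℕ) : ℤ) * a.period = k + n * a.period + a.period := by push_cast; ring
    rw [this, pos_add_period, ih, pow_succ, mul_assoc]

theorem pos_mul_period (n : ℕ) : a.pos (n * a.period) = a.elt ^ n := by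
  simpa using a.pos_add_mul_period 0 n

theorem letter_add_mul_period (k n : ℤ) : a.letter (k + n * a.period) = a.letter k := by
  induction n using Int.induction_on with
  | zero => simp
  | succ n ih => rw [add_mul, one_mul, ← add_assoc, a.periodic, ih]
  | pred n ih =>
    rw [← ih, ← a.periodic (k + (-n - 1) * a.period)]
    congr 1; ring

/-- Words act from the left, so the letter read first stands last; this is why the index is
reversed. -/
theorem pos_add_mul_inv (k : ℤ) (n : ℕ) :
    ∃ L : List (S × Bool), IsReduced L ∧ mk L = a.pos (k + n) * (a.pos k)⁻¹ ∧ L.length = n ∧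
      ∀ i : ℕ, i < n → L[n - 1 - i]? = some (a.letter (k + i)) := by
  induction n with
  | zero => exact ⟨[], by simp, by simp [one_eq_mk], rfl, by simp⟩
  | succ n ih =>
    obtain ⟨L, h₁, h₂, h₃, h₄⟩ := ih
    refine ⟨a.letter (k + n) :: L, ?_, ?_, by simp [h₃], ?_⟩
    · cases L with
      | nil => simp
      | cons x L =>
        rw [isReduced_cons_cons]
        refine ⟨fun h => ?_, h₁⟩
        have hn : n = L.length + 1 := by simpa using h₃.symm
        have hx := h₄ L.length (by omega)
        rw [hn] at hx
        simp only [Nat.add_sub_cancel, Nat.sub_self, List.getElem?_cons_zero,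
          Option.some.injEq] at hx
        have hr := a.reduced (k + L.length)
        rw [← hx] at hr
        rw [hn] at h ⊢
        push_cast at h ⊢
        rw [← add_assoc] at h ⊢
        by_contra hne
        exact hr (Prod.ext h (by simpa [invLetter] using Bool.eq_not_of_ne hne))
    · rw [← List.singleton_append, ← mul_mk, h₂]
      push_cast
      rw [← add_assoc, pos_succ, mul_assoc]
    · intro i hi
      rcases Nat.lt_succ_iff_lt_or_eq.1 hi with h | rfl
      · have : n + 1 - 1 - i = (n - 1 - i) + 1 := by omega
        rw [this, List.getElem?_cons_succ, h₄ i h]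
      · simp

/-- Equal rotations come from equal shifts. -/
theorem letter_eq_of_pos_eq {j k : ℤ}
    (h : a.pos j * a.elt * (a.pos j)⁻¹ = a.pos k * a.elt * (a.pos k)⁻¹) (t : ℤ) :
    a.letter (j + t) = a.letter (k + t) := by
  classical
  have hp := a.period_pos
  obtain ⟨L, h₁, h₂, h₃, h₄⟩ := a.pos_add_mul_inv j a.period
  obtain ⟨L', h₁', h₂', h₃', h₄'⟩ := a.pos_add_mul_inv k a.period
  rw [pos_add_period] at h₂ h₂'
  -- The rotation at `j` is the word read over one period from `j`; both lists are reduced words for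
  -- the same element.
  have hLL : L = L' := by
    rw [← h₁.reduce_eq, ← h₁'.reduce_eq]
    exact reduce.sound (by rw [h₂, h₂', h])
  have hmod := Int.emod_nonneg t (by omega : (a.period : ℤ) ≠ 0)
  have hlt := Int.emod_lt_of_pos t (by omega : (0 : ℤ) < a.period)
  have ht : t = (t % a.period).toNat + t / a.period * a.period := by
    rw [Int.toNat_of_nonneg hmod, mul_comm]; exact (Int.emod_add_mul_ediv t a.period).symm
  rw [ht, ← add_assoc, ← add_assoc, letter_add_mul_period, letter_add_mul_period]
  have e₁ := h₄ (t % a.period).toNat (by omega)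
  have e₂ := h₄' (t % a.period).toNat (by omega)
  rw [hLL, e₂] at e₁
  exact (Option.some.inj e₁).symm

/-- Every nontrivial element is conjugate to the translation of a periodic word. -/
theorem exists_isConj {g : FreeGroup S} (hg : g ≠ 1) :
    ∃ a : PeriodicWord S, IsConj a.elt g := by
  classical
  set L := reduceCyclically g.toWord with hL
  have hcyc : IsCyclicallyReduced L := reduceCyclically.isCyclicallyReduced isReduced_toWord
  have hconj : IsConj (mk L) g := by
    rw [isConj_iff]
    refine ⟨mk (reduceCyclically.conjugator g.toWord), ?_⟩
    rw [inv_mk, mul_mk, mul_mk, hL, reduceCyclically.conj_conjugator_reduceCyclically, mk_toWord]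
  have hne : L ≠ [] := by
    intro h
    rw [h, ← one_eq_mk, isConj_one_right] at hconj
    exact hg hconj
  have hlen : 0 < L.length := List.length_pos_of_ne_nil hne
  have hch : ∀ (i : ℕ) (h : i + 1 < L.length), L[i].1 = L[i + 1].1 → L[i].2 = L[i + 1].2 :=
    List.isChain_iff_getElem.1 hcyc.isReduced
  set n := L.length with hn
  let l (k : ℤ) : S × Bool := L[n - 1 - (k % n).toNat]
  have hl (k : ℤ) (i : ℕ) (hi : i < n) (h : n - 1 - (k % n).toNat = i) : l k = L[i] := by
    simp only [l, h]
  let a : PeriodicWord S :=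
    { letter := l
      period := n
      period_pos := hlen
      periodic := fun k => by simp only [l, Int.add_emod_right]
      reduced := fun k hk => by
        have hk1 := congrArg Prod.fst hk
        have hk2 := congrArg Prod.snd hk
        simp only [invLetter] at hk1 hk2
        have h0 := Int.emod_nonneg k (by omega : (n : ℤ) ≠ 0)
        have hlt := Int.emod_lt_of_pos k (by omega : (0 : ℤ) < n)
        -- At the seam between two periods cyclic reducedness is needed; elsewhere reducedness of
        -- `L` suffices.
        by_cases hlast : k % n + 1 = n
        · have hs : (k + 1) % n = 0 := by
            rw [Int.add_emod, ← Int.emod_add_mul_ediv k n]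
            have : k % n = n - 1 := by omega
            simp [this]
          rw [hl k 0 hlen (by omega), hl (k + 1) (n - 1) (by omega) (by simp [hs])] at hk1 hk2
          have := hcyc.2 L[n - 1] (by simp [List.getLast?_eq_getElem?, hn]) L[0]
            (by simp [List.head?_eq_getElem?]) hk1
          rw [this] at hk2
          simp at hk2
        · have hs : (k + 1) % n = k % n + 1 := by
            rw [Int.add_emod, Int.emod_eq_of_lt (a := 1) (by omega) (by omega)]
            exact Int.emod_eq_of_lt (by omega) (by omega)
          rw [hl k (n - 1 - ((k + 1) % n).toNat + 1) (by omega) (by omega),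
            hl (k + 1) (n - 1 - ((k + 1) % n).toNat) (by omega) rfl] at hk1 hk2
          have := hch (n - 1 - ((k + 1) % n).toNat) (by omega) hk1
          rw [this] at hk2
          simp at hk2 }
  refine ⟨a, ?_⟩
  have hpos : ∀ i : ℕ, i ≤ n → a.pos i = mk (L.drop (n - i)) := by
    intro i
    induction i with
    | zero => intro _; simp [hn, one_eq_mk]
    | succ i ih =>
      intro hi
      have hlt : n - (i + 1) < n := by omega
      have hsucc : n - (i + 1) + 1 = n - i := by omega
      have hmod : (i : ℤ) % n = i := Int.emod_eq_of_lt (by omega) (by omega)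
      push_cast
      rw [pos_succ, ih (by omega), List.drop_eq_getElem_cons hlt, hsucc,
        ← hl i (n - (i + 1)) hlt (by omega)]
      exact mul_mk
  have : a.elt = mk L := by
    rw [elt, hpos n le_rfl]; simp
  rwa [this]

/-- `a` is separated by `f` if points of its line are identified by `f` only when the lines
continue in the same way. -/
def Separated {G : Type*} [Group G] (f : FreeGroup S →* G) : Prop :=
  ∀ j k : ℤ, f (a.pos j) = f (a.pos k) → ∀ t, a.letter (j + t) = a.letter (k + t)

theorem finite_rotations : (Set.range fun j : ℤ => a.pos j * a.elt * (a.pos j)⁻¹).Finite := by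
  apply (Set.finite_Ico (0 : ℤ) a.period).image (fun j : ℤ => a.pos j * a.elt * (a.pos j)⁻¹)
    |>.subset
  rintro _ ⟨j, rfl⟩
  have hp := a.period_pos
  have hstep (k : ℤ) : a.pos (k + a.period) * a.elt * (a.pos (k + a.period))⁻¹ =
      a.pos k * a.elt * (a.pos k)⁻¹ := by rw [pos_add_period]; group
  have hall (k n : ℤ) : a.pos (k + n * a.period) * a.elt * (a.pos (k + n * a.period))⁻¹ =
      a.pos k * a.elt * (a.pos k)⁻¹ := by
    induction n using Int.induction_on with
    | zero => simp
    | succ n ih => rw [add_mul, one_mul, ← add_assoc, hstep, ih]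
    | pred n ih =>
      rw [← ih, ← hstep (k + (-n - 1) * a.period)]
      congr! 3 <;> ring
  refine ⟨j % a.period, ⟨Int.emod_nonneg _ (by omega), Int.emod_lt_of_pos _ (by omega)⟩, ?_⟩
  have := hall (j % a.period) (j / a.period)
  rw [mul_comm (j / a.period), Int.emod_add_mul_ediv] at this
  exact this.symm

/-- The lines have finitely many rotations, so a finite quotient distinguishes them. Points with
equal images have rotations with equal images, hence equal rotations and equal continuations. -/
theorem exists_separated {ι : Type*} [Finite ι] (c : ι → PeriodicWord S) :
    ∃ N : Subgroup (FreeGroup S), ∃ _ : N.Normal, N.FiniteIndex ∧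
      ∀ i, (c i).Separated (QuotientGroup.mk' N) := by
  obtain ⟨N, hN, hfin, hinj⟩ := exists_normal_injOn
    (⋃ i, Set.range fun j : ℤ => (c i).pos j * (c i).elt * ((c i).pos j)⁻¹)
    (Set.finite_iUnion fun i => (c i).finite_rotations)
  refine ⟨N, hN, hfin, fun i j k h => (c i).letter_eq_of_pos_eq ?_⟩
  refine hinj _ (Set.mem_iUnion.2 ⟨i, j, rfl⟩) _ (Set.mem_iUnion.2 ⟨i, k, rfl⟩) ?_
  rw [← QuotientGroup.eq]
  change QuotientGroup.mk' N _ = QuotientGroup.mk' N _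
  simp only [_root_.map_mul, _root_.map_inv, h]

variable {a b}

/-- After `a.period * b.period` steps along the same path both lines have advanced a whole number of
periods. -/
theorem isConj_of_letter_eq {j k : ℤ} (h : ∀ t : ℕ, b.letter (j + t) = a.letter (k + t)) :
    IsConj (a.elt ^ b.period) (b.elt ^ a.period) := by
  have key : ∀ t : ℕ, b.pos (j + t) * (b.pos j)⁻¹ = a.pos (k + t) * (a.pos k)⁻¹ := by
    intro t
    induction t with
    | zero => simp
    | succ t ih =>
      push_cast
      rw [← add_assoc, ← add_assoc, pos_succ, pos_succ, h, mul_assoc, ih, mul_assoc]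
  have hk := key (a.period * b.period)
  have e : ((a.period * b.period : ℕ) : ℤ) = b.period * a.period := by push_cast; ring
  rw [Nat.cast_mul, pos_add_mul_period, ← Nat.cast_mul, e, pos_add_mul_period] at hk
  rw [isConj_iff]
  refine ⟨(b.pos j)⁻¹ * a.pos k, ?_⟩
  rw [mul_inv_rev, inv_inv]
  calc _ = (b.pos j)⁻¹ * (a.pos k * a.elt ^ b.period * (a.pos k)⁻¹) * b.pos j := by group
    _ = _ := by rw [← hk]; group

/-- Here `b` follows `a` backwards, starting from the end of the edge at time `k`, that is, from the
vertex at time `k + 1`. -/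
theorem isConj_of_letter_eq_inv {j k : ℤ}
    (h : ∀ t : ℕ, b.letter (j + t) = invLetter (a.letter (k - t))) :
    IsConj ((a.elt ^ b.period)⁻¹) (b.elt ^ a.period) := by
  have key : ∀ t : ℕ, b.pos (j + t) * (b.pos j)⁻¹ = a.pos (k + 1 - t) * (a.pos (k + 1))⁻¹ := by
    intro t
    induction t with
    | zero => simp
    | succ t ih =>
      have hs := a.pos_succ (k - t)
      have e₁ : k - (t : ℤ) + 1 = k + 1 - t := by ring
      have e₂ : k + 1 - ((t + 1 : ℕ) : ℤ) = k - t := by push_cast; ring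
      rw [e₁] at hs
      rw [e₂]
      push_cast
      rw [← add_assoc, pos_succ, h, mul_assoc, ih, hs, mk_invLetter]
      group
  have hk := key (a.period * b.period)
  have e : ((a.period * b.period : ℕ) : ℤ) = b.period * a.period := by push_cast; ring
  have hb := a.pos_add_mul_period (k + 1 - b.period * a.period) b.period
  rw [sub_add_cancel] at hb
  rw [Nat.cast_mul, pos_add_mul_period, ← Nat.cast_mul, e, hb] at hk
  rw [isConj_iff]
  refine ⟨(b.pos j)⁻¹ * (a.pos (k + 1 - b.period * a.period) * a.elt ^ b.period), ?_⟩
  have hk' : b.elt ^ a.period = (b.pos j)⁻¹ * (b.pos j * b.elt ^ a.period * (b.pos j)⁻¹) *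
    b.pos j := by group
  rw [hk', hk]
  group

end PeriodicWord
end FreeGroup

/-! ### Lines and weights in finite Cayley graphs. -/

namespace FreeGroup

variable {S X A : Type*} [AddCommGroup A] (ρ : FreeGroup S →* Equiv.Perm X)

/-- The positively oriented edge which is traversed by the letter `x` starting at `y`. -/
def edge (x : S × Bool) (y : X) : S × X :=
  (x.1, if x.2 then y else (ρ (of x.1))⁻¹ y)

/-- The direction in which a letter traverses its edge. -/
def letterSign (x : S × Bool) : ℤ := if x.2 then 1 else -1

theorem cocycle_letter (ω : S → X → A) (x : S × Bool) (y : X) :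
    cocycle ρ ω (mk [x]) y = letterSign x • ω (edge ρ x y).1 (edge ρ x y).2 := by
  rcases x with ⟨s, _ | _⟩
  · simp [mk_false, cocycle_inv, edge, letterSign]
  · simp [mk_true, edge, letterSign]

theorem edge_eq_edge {x x' : S × Bool} {y y' : X} (h : edge ρ x y = edge ρ x' y') :
    (x = x' ∧ y = y') ∨ (x = invLetter x' ∧ y = ρ (mk [x']) y') := by
  rcases x with ⟨s, _ | _⟩ <;> rcases x' with ⟨s', _ | _⟩ <;>
    simp only [edge, Prod.mk.injEq] at h <;> obtain ⟨rfl, h⟩ := h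
  · left; simpa using h
  · right; exact ⟨by simp [invLetter], Equiv.Perm.inv_eq_iff_eq.1 h⟩
  · right; simpa [invLetter, mk_false] using h
  · left; simpa using h

namespace PeriodicWord

variable (a b : PeriodicWord S)

theorem cocycle_pos (ω : S → X → A) (v : X) (k : ℕ) :
    cocycle ρ ω (a.pos k) v =
      ∑ i ∈ Finset.range k, cocycle ρ ω (mk [a.letter i]) (ρ (a.pos i) v) := by
  induction k with
  | zero => simp
  | succ k ih =>
    push_cast
    rw [pos_succ, cocycle_mul, ih, Finset.sum_range_succ]

end PeriodicWord

/-- The action of a free group on the Cayley graph of a quotient. -/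
def cayley {G : Type*} [Group G] (f : FreeGroup S →* G) : FreeGroup S →* Equiv.Perm G :=
  (MulAction.toPermHom G G).comp f

@[simp] theorem cayley_apply {G : Type*} [Group G] (f : FreeGroup S →* G) (w : FreeGroup S)
    (v : G) : cayley f w v = f w * v := rfl

namespace PeriodicWord

variable {a b : PeriodicWord S} {G : Type*} [Group G] {f : FreeGroup S →* G}

/-- The edge of the Cayley graph traversed at time `k` by the line of `a` based at `v`. -/
def edgeAt (a : PeriodicWord S) (f : FreeGroup S →* G) (v : G) (k : ℤ) : S × G :=
  edge (cayley f) (a.letter k) (cayley f (a.pos k) v)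

/-- Traversing the edge both ways would identify times `j` and `k + 1`; by separation the letter at
`k + 1` would then undo the letter at `k`. -/
theorem letter_eq_of_edgeAt_eq (ha : a.Separated f) {v : G} {j k : ℤ}
    (h : a.edgeAt f v j = a.edgeAt f v k) : a.letter j = a.letter k := by
  rcases edge_eq_edge _ h with h | ⟨h₁, h₂⟩
  · exact h.1
  · rw [← Equiv.Perm.mul_apply, ← _root_.map_mul, ← pos_succ, cayley_apply, cayley_apply,
      mul_left_inj] at h₂
    have := ha _ _ h₂ 0
    rw [add_zero, add_zero, h₁] at this
    exact absurd this.symm (a.reduced k)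

/-- The indicator weight of an edge. -/
def edgeIndicator [DecidableEq S] [DecidableEq X] (e : S × X) (s : S) (y : X) : ℤ :=
  if e = (s, y) then 1 else 0

/-- No cancellation occurs: all passages of the closed line through the edge have the same
direction, and there is at least one. -/
theorem cocycle_edgeIndicator_ne_zero [DecidableEq S] [DecidableEq G] (ha : a.Separated f)
    (v : G) (j : ℤ) {n : ℕ} (hn : 0 < n) (hf : f (a.elt ^ n) = 1) :
    cocycle (cayley f) (edgeIndicator (a.edgeAt f v j)) (a.elt ^ n) v ≠ 0 := by
  have hp : 0 < n * a.period := Nat.mul_pos hn a.period_pos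
  set N := n * a.period with hN
  have h₀ := Int.emod_nonneg j (by omega : (N : ℤ) ≠ 0)
  have hlt := Int.emod_lt_of_pos j (by omega : (0 : ℤ) < N)
  have hfpos (k q : ℤ) : f (a.pos (k + q * N)) = f (a.pos k) := by
    have hs (k : ℤ) : f (a.pos (k + N)) = f (a.pos k) := by
      rw [hN, Nat.cast_mul, pos_add_mul_period, _root_.map_mul, hf, mul_one]
    induction q using Int.induction_on with
    | zero => simp
    | succ q ih => rw [add_mul, one_mul, ← add_assoc, hs, ih]
    | pred q ih =>
      rw [← ih, ← hs (k + (-q - 1) * N)]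
      congr 2; ring
  have hj : a.edgeAt f v (j % N).toNat = a.edgeAt f v j := by
    have e : j = (j % N).toNat + j / N * N := by
      rw [Int.toNat_of_nonneg h₀, mul_comm]; exact (Int.emod_add_mul_ediv j N).symm
    have hl : a.letter j = a.letter (j % N).toNat := by
      conv_lhs => rw [e]
      rw [hN, Nat.cast_mul, ← mul_assoc, letter_add_mul_period]
    have hpj : f (a.pos j) = f (a.pos (j % N).toNat) := by
      conv_lhs => rw [e]
      exact hfpos _ _
    simp only [edgeAt, cayley_apply, hl, hpj]
  have hterm (i : ℕ) : cocycle (cayley f) (edgeIndicator (a.edgeAt f v j))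
      (mk [a.letter i]) (cayley f (a.pos i) v) =
      letterSign (a.letter j) * if a.edgeAt f v j = a.edgeAt f v i then 1 else 0 := by
    rw [cocycle_letter, smul_eq_mul]
    change _ * (if a.edgeAt f v j = a.edgeAt f v i then 1 else 0) = _
    split_ifs with h
    · rw [letter_eq_of_edgeAt_eq ha h]
    · simp
  rw [← pos_mul_period, ← Nat.cast_mul, cocycle_pos, Finset.sum_congr rfl fun i _ => hterm i,
    ← Finset.mul_sum]
  refine mul_ne_zero (by unfold letterSign; split_ifs <;> simp) (ne_of_gt ?_)
  refine Finset.sum_pos' (fun i _ => by split_ifs <;> simp) ⟨(j % N).toNat, ?_, ?_⟩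
  · rw [Finset.mem_range]; omega
  · rw [hj]; simp

/-- If the lines of `a` and `b` are not commensurable, then every line labelled by `b` in the Cayley
graph leaves the line of `a`. -/
theorem exists_edgeAt_ne (ha : a.Separated f) (v : G)
    (hne : ∀ m n : ℤ, m ≠ 0 → n ≠ 0 → ¬ IsConj (a.elt ^ m) (b.elt ^ n)) :
    ∃ k : ℤ, ∀ j : ℤ, a.edgeAt f 1 j ≠ b.edgeAt f v k := by
  by_contra! hall
  have hla : (a.period : ℤ) ≠ 0 := by have := a.period_pos; omega
  have hlb : (b.period : ℤ) ≠ 0 := by have := b.period_pos; omega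
  have hinv (k : ℤ) : b.letter k ≠ invLetter (b.letter (k + 1)) := fun h =>
    b.reduced k (by rw [h, invLetter_invLetter])
  have hcross (k : ℤ) : ∃ j : ℤ, (a.letter j = b.letter k ∧ f (a.pos j) = f (b.pos k) * v) ∨
      (a.letter j = invLetter (b.letter k) ∧ f (a.pos j) = f (b.pos (k + 1)) * v ∧
        f (a.pos (j + 1)) = f (b.pos k) * v) := by
    obtain ⟨j, hj⟩ := hall k
    refine ⟨j, ?_⟩
    rcases edge_eq_edge _ hj with h | ⟨h₁, h₂⟩
    · left; simpa using h
    · right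
      rw [← Equiv.Perm.mul_apply, ← _root_.map_mul, ← pos_succ, cayley_apply, cayley_apply,
        mul_one] at h₂
      refine ⟨h₁, h₂, ?_⟩
      rw [pos_succ, _root_.map_mul, h₂, h₁, mk_invLetter, pos_succ, _root_.map_mul,
        _root_.map_inv, mul_assoc, inv_mul_cancel_left]
  -- The direction found at time `0` persists: a change would make `b` backtrack, and otherwise
  -- separation matches the next letters. A common ray then forces conjugate powers.
  obtain ⟨j, ⟨h₁, h₂⟩ | ⟨h₁, h₂, -⟩⟩ := hcross 0
  · have key : ∀ t : ℕ, a.letter (j + t) = b.letter (0 + t) ∧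
        f (a.pos (j + t)) = f (b.pos (0 + t)) * v := by
      intro t
      induction t with
      | zero => simpa only [Nat.cast_zero, add_zero, sub_zero] using ⟨h₁, h₂⟩
      | succ t ih =>
        obtain ⟨ih₁, ih₂⟩ := ih
        push_cast
        rw [← add_assoc, ← add_assoc]
        have hpos : f (a.pos (j + t + 1)) = f (b.pos (0 + t + 1)) * v := by
          rw [pos_succ, pos_succ, _root_.map_mul, _root_.map_mul, ih₁, ih₂, mul_assoc]
        obtain ⟨j', ⟨h₁', h₂'⟩ | ⟨h₁', -, h₂'⟩⟩ := hcross (0 + t + 1)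
        · have := ha _ _ (h₂'.trans hpos.symm) 0
          rw [add_zero, add_zero, h₁'] at this
          exact ⟨this.symm, hpos⟩
        · have := ha _ _ (h₂'.trans hpos.symm) (-1)
          rw [add_neg_cancel_right, add_neg_cancel_right, h₁', ih₁] at this
          exact absurd this.symm (hinv _)
    have := isConj_of_letter_eq fun t => (key t).1.symm
    exact hne b.period a.period hlb hla (by simpa using this)
  · have key : ∀ t : ℕ, a.letter (j - t) = invLetter (b.letter (0 + t)) ∧
        f (a.pos (j - t)) = f (b.pos (0 + t + 1)) * v := by
      intro t
      induction t with
      | zero => simpa only [Nat.cast_zero, add_zero, sub_zero] using ⟨h₁, h₂⟩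
      | succ t ih =>
        obtain ⟨ih₁, ih₂⟩ := ih
        push_cast
        rw [← add_assoc, sub_add_eq_sub_sub]
        obtain ⟨j', ⟨h₁', h₂'⟩ | ⟨h₁', -, h₂'⟩⟩ := hcross (0 + t + 1)
        · have := ha _ _ (h₂'.trans ih₂.symm) 0
          rw [add_zero, add_zero, h₁', ih₁] at this
          exact absurd this (b.reduced _)
        · have := ha _ _ (h₂'.trans ih₂.symm) (-1)
          rw [add_neg_cancel_right, ← sub_eq_add_neg, h₁'] at this
          refine ⟨this.symm, ?_⟩
          have hs := a.pos_succ (j - t - 1)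
          rw [sub_add_cancel] at hs
          rw [hs, ← this, mk_invLetter, _root_.map_mul, _root_.map_inv, inv_mul_eq_iff_eq_mul]
            at ih₂
          rw [ih₂, b.pos_succ (0 + t + 1), _root_.map_mul, mul_assoc]
    have := isConj_of_letter_eq_inv (a := a) (b := b) (j := 0) (k := j)
      fun t => by rw [(key t).1, invLetter_invLetter]
    exact hne (-b.period) a.period (neg_ne_zero.2 hlb) hla (by simpa using this)

/-- There are weights on the Cayley graph which vanish along the line of `a` but not along any
line of the words `c i`. -/
theorem exists_weights {ι : Type*} [Finite ι] [Finite G] (a : PeriodicWord S)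
    (c : ι → PeriodicWord S) (ha : a.Separated f) (hc : ∀ i, (c i).Separated f)
    (hne : ∀ i, ∀ m n : ℤ, m ≠ 0 → n ≠ 0 → ¬ IsConj (a.elt ^ m) ((c i).elt ^ n))
    {n : ℕ} (hn : 0 < n) (hG : ∀ x : G, x ^ n = 1) :
    ∃ ω : S → G → ℤ, (∀ j, ω (a.edgeAt f 1 j).1 (a.edgeAt f 1 j).2 = 0) ∧
      ∀ i v, cocycle (cayley f) ω ((c i).elt ^ n) v ≠ 0 := by
  classical
  have := Fintype.ofFinite ι
  have := Fintype.ofFinite G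
  -- Generic weights: an independent variable on each edge off the line of `a`. A single integer
  -- point where a product of nonzero polynomials survives then serves all `i` and `v` at once.
  let u (s : S) (y : G) : MvPolynomial (S × G) ℤ :=
    if ∀ j, a.edgeAt f 1 j ≠ (s, y) then MvPolynomial.X (s, y) else 0
  have hu : ∀ i v, cocycle (cayley f) u ((c i).elt ^ n) v ≠ 0 := by
    intro i v h
    obtain ⟨k, hk⟩ := exists_edgeAt_ne ha v (hne i)
    apply cocycle_edgeIndicator_ne_zero (hc i) v k hn (by rw [map_pow, hG])
    -- Taking one coefficient turns the generic weights into the indicator of an edge off the line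
    -- of `a`.
    let φ : MvPolynomial (S × G) ℤ →+ ℤ :=
      (MvPolynomial.lcoeff ℤ (Finsupp.single ((c i).edgeAt f v k) 1)).toAddMonoidHom
    have hφ : edgeIndicator ((c i).edgeAt f v k) = fun s y => φ (u s y) := by
      funext s y
      change _ = MvPolynomial.coeff _ (u s y)
      unfold edgeIndicator
      split_ifs with he
      · have : ∀ j, a.edgeAt f 1 j ≠ (s, y) := fun j => he ▸ hk j
        simp [u, this, he]
      · by_cases hs : ∀ j, a.edgeAt f 1 j ≠ (s, y)
        · have hsingle : Finsupp.single (s, y) 1 ≠ Finsupp.single ((c i).edgeAt f v k) 1 :=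
            fun h => he ((Finsupp.single_left_inj one_ne_zero).1 h).symm
          rw [show u s y = MvPolynomial.X (s, y) from if_pos hs, MvPolynomial.coeff_X,
            if_neg hsingle]
        · rw [show u s y = 0 from if_neg hs, MvPolynomial.coeff_zero]
    rw [hφ, cocycle_map, h, map_zero]
  have hprod : (∏ p : ι × G, cocycle (cayley f) u ((c p.1).elt ^ n) p.2) ≠ 0 :=
    Finset.prod_ne_zero_iff.2 fun p _ => hu p.1 p.2
  obtain ⟨τ, hτ⟩ : ∃ τ : S × G → ℤ, MvPolynomial.eval τ
      (∏ p : ι × G, cocycle (cayley f) u ((c p.1).elt ^ n) p.2) ≠ 0 := by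
    by_contra! h
    exact hprod (MvPolynomial.funext fun τ => by rw [h, map_zero])
  refine ⟨fun s y => (MvPolynomial.eval τ).toAddMonoidHom (u s y), fun j => ?_, fun i v => ?_⟩
  · have : u (a.edgeAt f 1 j).1 (a.edgeAt f 1 j).2 = 0 := if_neg fun h => h j rfl
    change (MvPolynomial.eval τ).toAddMonoidHom _ = 0
    rw [this, map_zero]
  · rw [cocycle_map]
    rw [map_prod] at hτ
    exact Finset.prod_ne_zero_iff.1 hτ (i, v) (Finset.mem_univ _)

end PeriodicWord
end FreeGroup

/-! ### Cyclic covers of prime order and characters on free groups. -/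

namespace FreeGroup

universe u

variable {S : Type u}

theorem sum_range_zmod {A : Type*} [AddCommMonoid A] (p : ℕ) [NeZero p] (F : ZMod p → A) :
    ∑ j ∈ Finset.range p, F j = ∑ z, F z :=
  Finset.sum_nbij' (fun j => (j : ZMod p)) ZMod.val (by simp)
    (fun z _ => Finset.mem_range.2 (ZMod.val_lt z))
    (fun j hj => ZMod.val_natCast_of_lt (Finset.mem_range.1 hj))
    (fun z _ => ZMod.natCast_zmod_val z) (fun _ _ => rfl)

/-- A path which moves each fibre of a cyclic extension of prime order to itself, without fixed
points, becomes closed after `p` turns, and balanced weights then sum to zero along it. -/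
theorem cocycle_pow_prime_eq_zero {X A : Type*} [AddCommGroup A] {p : ℕ} [Fact p.Prime]
    {ρ : FreeGroup S →* Equiv.Perm X} {η : S → X → ZMod p} {θ : S → X × ZMod p → A}
    (hθ : ∀ s y, ∑ b, θ s (y, b) = 0) {w : FreeGroup S} {v : X} (hv : ρ w v = v)
    (hd : cocycle ρ η w v ≠ 0) (z : ZMod p) :
    skewAction ρ η (w ^ p) (v, z) = (v, z) ∧ cocycle (skewAction ρ η) θ (w ^ p) (v, z) = 0 := by
  have key : ∀ m : ℕ, skewAction ρ η (w ^ m) (v, z) = (v, z + m * cocycle ρ η w v) ∧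
      cocycle (skewAction ρ η) θ (w ^ m) (v, z) =
        ∑ j ∈ Finset.range m, cocycle (skewAction ρ η) θ w (v, z + j * cocycle ρ η w v) := by
    intro m
    induction m with
    | zero => simp
    | succ m ih =>
      rw [pow_succ', _root_.map_mul, Equiv.Perm.mul_apply, ih.1, skewAction_apply, hv, cocycle_mul,
        ih.1, ih.2, Finset.sum_range_succ]
      refine ⟨?_, rfl⟩
      push_cast
      congr 1
      ring
  refine ⟨by rw [(key p).1]; simp, ?_⟩
  rw [(key p).2, sum_range_zmod p fun x =>
    cocycle (skewAction ρ η) θ w (v, z + x * cocycle ρ η w v), ← sum_cocycle_skewAction ρ η θ hθ w v]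
  -- One turn shifts the fibre by a nonzero element of the field `ZMod p`, so `p` turns meet each
  -- sheet exactly once.
  exact Fintype.sum_equiv ((Equiv.mulRight₀ _ hd).trans (Equiv.addLeft z)) _ _ fun x => rfl

theorem PeriodicWord.exists_cocycle {ι : Type*} [Finite ι] (a : PeriodicWord S)
    (c : ι → PeriodicWord S)
    (hne : ∀ i, ∀ m n : ℤ, m ≠ 0 → n ≠ 0 → ¬ IsConj (a.elt ^ m) ((c i).elt ^ n)) :
    ∃ (X : Type u) (_ : Finite X) (ρ : FreeGroup S →* Equiv.Perm X) (ω : S → X → ℤ),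
      (∀ i (k : ℤ) x, ρ ((c i).elt ^ k) = 1 → cocycle ρ ω ((c i).elt ^ k) x = 0) ∧
      ∃ (n : ℕ) (x : X), ρ (a.elt ^ n) = 1 ∧ cocycle ρ ω (a.elt ^ n) x ≠ 0 := by
  classical
  obtain ⟨N, hN, hfin, hsep⟩ := exists_separated fun i : Option ι => i.elim a c
  have ha : a.Separated (QuotientGroup.mk' N) := hsep none
  have hc : ∀ i, (c i).Separated (QuotientGroup.mk' N) := fun i => hsep (some i)
  have : Finite (FreeGroup S ⧸ N) := Subgroup.finite_quotient_of_finiteIndex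
  set f := QuotientGroup.mk' N
  set n := Nat.card (FreeGroup S ⧸ N)
  have hn : 0 < n := Nat.card_pos
  have hG : ∀ x : FreeGroup S ⧸ N, x ^ n = 1 := fun x => pow_card_eq_one'
  obtain ⟨ω, hω, hω'⟩ := exists_weights a c ha hc hne hn hG
  obtain ⟨M, hM⟩ := (Set.finite_range fun q : ι × (FreeGroup S ⧸ N) =>
    (cocycle (cayley f) ω ((c q.1).elt ^ n) q.2).natAbs).bddAbove
  -- A prime above all the sums keeps the nonzero ones nonzero modulo `p`.
  obtain ⟨p, hpM, hp⟩ := Nat.exists_infinite_primes (M + 1)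
  have : Fact p.Prime := ⟨hp⟩
  let η : S → (FreeGroup S ⧸ N) → ZMod p := fun s y => Int.castAddHom (ZMod p) (ω s y)
  have hη (w v) : cocycle (cayley f) η w v = (cocycle (cayley f) ω w v : ℤ) :=
    cocycle_map _ _ (Int.castAddHom (ZMod p)) w v
  have hη0 (i v) : cocycle (cayley f) η ((c i).elt ^ n) v ≠ 0 := by
    rw [hη, Ne, ZMod.intCast_zmod_eq_zero_iff_dvd]
    intro h
    have h₁ := Nat.le_of_dvd (Int.natAbs_pos.2 (hω' i v)) (Int.natCast_dvd.1 h)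
    have h₂ := hM ⟨(i, v), rfl⟩
    simp only at h₂
    omega
  set e := a.edgeAt f 1 0
  -- Balanced over each fibre, yet equal to the indicator of `e` on sheet `0`.
  let θ : S → (FreeGroup S ⧸ N) × ZMod p → ℤ := fun s y =>
    edgeIndicator e s y.1 * ((if y.2 = 0 then 1 else 0) - (if y.2 = 1 then 1 else 0))
  have hθ (s y) : ∑ b, θ s (y, b) = 0 := by
    simp only [θ]
    rw [← Finset.mul_sum, Finset.sum_sub_distrib]
    simp
  have hfn (g : FreeGroup S) : f (g ^ n) = 1 := by rw [map_pow, hG]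
  refine ⟨(FreeGroup S ⧸ N) × ZMod p, inferInstance, skewAction (cayley f) η, θ, ?_, ?_⟩
  · rintro i k x hk
    obtain ⟨v, z⟩ := x
    obtain ⟨h₁, h₂⟩ := cocycle_pow_prime_eq_zero (ρ := cayley f) hθ
      (by rw [cayley_apply, hfn, one_mul]) (hη0 i v) z
    -- Two computations of the weight of the same power: `n * p` times the wanted value, and zero.
    have h₃ := cocycle_pow (skewAction (cayley f) η) θ
      (u := (c i).elt ^ k) (x := (v, z)) (by rw [hk]; rfl) (n * p)
    have h₄ := cocycle_zpow (skewAction (cayley f) η) θ h₁ k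
    have hcomm : ((c i).elt ^ k) ^ (n * p) = (((c i).elt ^ n) ^ p) ^ k := by
      rw [← pow_mul, ← zpow_natCast, ← zpow_natCast, zpow_comm]
    rw [hcomm, h₄, h₂, smul_zero, eq_comm, smul_eq_zero] at h₃
    exact h₃.resolve_left (Nat.mul_pos hn hp.pos).ne'
  -- Since `ω` vanishes along it, the line of `a` never leaves sheet `0`.
  · have key : ∀ k : ℕ, skewAction (cayley f) η (a.pos k) (1, 0) = (cayley f (a.pos k) 1, 0) ∧
        cocycle (skewAction (cayley f) η) θ (a.pos k) (1, 0) =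
          cocycle (cayley f) (edgeIndicator e) (a.pos k) 1 := by
      intro k
      induction k with
      | zero => simp
      | succ k ih =>
        have hz : cocycle (cayley f) η (mk [a.letter k]) (cayley f (a.pos k) 1) = 0 := by
          rw [hη, cocycle_letter]
          have := hω k
          rw [edgeAt] at this
          rw [this]; simp
        push_cast
        rw [pos_succ, _root_.map_mul, Equiv.Perm.mul_apply, ih.1, skewAction_apply, hz,
          cocycle_mul, cocycle_mul, ih.1, ih.2, _root_.map_mul, add_zero]
        refine ⟨rfl, ?_⟩
        congr 1
        rw [cocycle_letter, cocycle_letter]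
        have hedge : edge (skewAction (cayley f) η) (a.letter k) (cayley f (a.pos k) 1, 0) =
            ((edge (cayley f) (a.letter k) (cayley f (a.pos k) 1)).1,
              (edge (cayley f) (a.letter k) (cayley f (a.pos k) 1)).2, 0) := by
          generalize cayley f (a.pos k) 1 = y at hz
          generalize a.letter k = x at hz
          rcases x with ⟨s, _ | _⟩
          · simp only [edge, Bool.false_eq_true, if_false, ← _root_.map_inv, skewAction_apply]
            rw [← mk_false, hz, add_zero]
          · simp [edge]
        rw [hedge]
        simp [θ]
    have hne0 := cocycle_edgeIndicator_ne_zero ha 1 0 hn (hfn a.elt)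
    have hfix := (key (n * a.period)).1
    have hval := (key (n * a.period)).2
    rw [Nat.cast_mul, pos_mul_period] at hfix hval
    rw [cayley_apply, hfn, one_mul] at hfix
    -- A further power makes the word act trivially everywhere, not only at `(1, 0)`.
    set m := Nat.card (Equiv.Perm ((FreeGroup S ⧸ N) × ZMod p))
    refine ⟨n * m, (1, 0), by rw [pow_mul, map_pow, pow_card_eq_one'], ?_⟩
    rw [pow_mul, cocycle_pow _ _ hfix, hval]
    exact smul_ne_zero Nat.card_pos.ne' hne0

/-- Virtual homological independence: in a finite-index subgroup of a free group, a power of `g` is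
detected by an integral character which ignores the powers of all conjugates of the `h i`. -/
theorem exists_finiteIndex_character {ι : Type*} [Finite ι] (g : FreeGroup S)
    (h : ι → FreeGroup S) (hg : g ≠ 1) (hh : ∀ i, h i ≠ 1)
    (hne : ∀ i, ∀ m n : ℤ, m ≠ 0 → n ≠ 0 → ¬ IsConj (g ^ m) (h i ^ n)) :
    ∃ (K : Subgroup (FreeGroup S)) (φ : K →* Multiplicative ℤ), K.FiniteIndex ∧
      (∀ i t (k : ℤ) (hk : t * h i ^ k * t⁻¹ ∈ K), φ ⟨_, hk⟩ = 1) ∧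
      ∃ (t : FreeGroup S) (n : ℕ) (hn : t * g ^ n * t⁻¹ ∈ K), φ ⟨_, hn⟩ ≠ 1 := by
  obtain ⟨a, ha⟩ := PeriodicWord.exists_isConj hg
  choose c hc using fun i => PeriodicWord.exists_isConj (hh i)
  have hcz {x y : FreeGroup S} (hxy : IsConj x y) (k : ℤ) : IsConj (x ^ k) (y ^ k) := by
    obtain ⟨u, rfl⟩ := isConj_iff.1 hxy
    exact isConj_iff.2 ⟨u, conj_zpow.symm⟩
  obtain ⟨X, _, ρ, ω, h₁, n, x, h₂, h₃⟩ := PeriodicWord.exists_cocycle a c fun i m n hm hn hmn =>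
    hne i m n hm hn (((hcz ha m).symm.trans hmn).trans (hcz (hc i) n))
  refine ⟨ρ.ker,
    { toFun := fun w => Multiplicative.ofAdd (cocycle ρ ω w x)
      map_one' := by simp
      map_mul' := fun u v => by
        have hv : ρ v = 1 := v.2
        rw [Subgroup.coe_mul, cocycle_mul, hv, add_comm]; rfl }, Subgroup.finiteIndex_ker ρ, ?_, ?_⟩
  · intro i t k hk
    obtain ⟨u, hu⟩ := isConj_iff.1 (hc i)
    have hconj : t * h i ^ k * t⁻¹ = (t * u) * (c i).elt ^ k * (t * u)⁻¹ := by
      rw [← hu, conj_zpow]; group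
    have hk' : ρ ((c i).elt ^ k) = 1 := by
      rw [hconj] at hk
      have := (MonoidHom.normal_ker ρ).conj_mem _ hk (t * u)⁻¹
      rwa [show (t * u)⁻¹ * (t * u * (c i).elt ^ k * (t * u)⁻¹) * (t * u)⁻¹⁻¹ = (c i).elt ^ k by
        group] at this
    change Multiplicative.ofAdd (cocycle ρ ω (t * h i ^ k * t⁻¹) x) = 1
    rw [hconj, cocycle_conj ρ ω hk', h₁ i k _ hk', ofAdd_zero]
  · obtain ⟨u, hu⟩ := isConj_iff.1 ha
    have hconj : u⁻¹ * g ^ n * u⁻¹⁻¹ = a.elt ^ n := by rw [← hu, conj_pow]; group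
    refine ⟨u⁻¹, n, by rw [hconj]; exact h₂, ?_⟩
    change Multiplicative.ofAdd (cocycle ρ ω (u⁻¹ * g ^ n * u⁻¹⁻¹) x) ≠ 1
    rw [hconj]
    exact h₃

end FreeGroup

/-! ### Transfer to virtually free groups. -/

theorem IsVirtuallyFree.exists_normal {Γ : Type*} [Group Γ] (hΓ : IsVirtuallyFree Γ) :
    ∃ Λ : Subgroup Γ, Λ.Normal ∧ Λ.FiniteIndex ∧ IsFreeGroup Λ := by
  obtain ⟨Λ, hfin, hfree⟩ := hΓ
  -- Nielsen–Schreier: the normal core is free, as a subgroup of a free group.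
  exact ⟨Λ.normalCore, inferInstance, inferInstance,
    IsFreeGroup.ofMulEquiv (Subgroup.subgroupOfEquivOfLe Λ.normalCore_le)⟩

/-- The analogue of `FreeGroup.exists_finiteIndex_character` for virtually free groups. -/
theorem IsVirtuallyFree.exists_normal_character {Γ : Type*} [Group Γ] (hΓ : IsVirtuallyFree Γ)
    {ι : Type*} [Finite ι] (g : Γ) (h : ι → Γ) (hg : ¬ IsOfFinOrder g)
    (hh : ∀ i, ¬ IsOfFinOrder (h i))
    (hne : ∀ i, ∀ m n : ℤ, m ≠ 0 → n ≠ 0 → ¬ IsConj (g ^ m) (h i ^ n)) :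
    ∃ (K : Subgroup Γ) (φ : K →* Multiplicative ℤ), K.Normal ∧ K.FiniteIndex ∧
      (∀ i t (k : ℤ) (x : K), (x : Γ) = t * h i ^ k * t⁻¹ → φ x = 1) ∧
      ∃ (t : Γ) (n : ℕ) (x : K), (x : Γ) = t * g ^ n * t⁻¹ ∧ φ x ≠ 1 := by
  obtain ⟨Λ, hnor, hfin, hfree⟩ := hΓ.exists_normal
  have : Finite (Γ ⧸ Λ) := Subgroup.finite_quotient_of_finiteIndex
  let e : Λ ≃* FreeGroup (IsFreeGroup.Generators Λ) := IsFreeGroup.toFreeGroup Λ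
  set N := Λ.index
  have hN : 0 < N := Nat.pos_of_ne_zero Subgroup.FiniteIndex.index_ne_zero
  have hNZ : (N : ℤ) ≠ 0 := by omega
  have hpow (x : Γ) : x ^ N ∈ Λ := Subgroup.pow_index_mem Λ x
  have hpow' (x : Γ) (q : Γ ⧸ Λ) : q.out⁻¹ * x ^ N * q.out ∈ Λ := by
    simpa using hnor.conj_mem _ (hpow x) q.out⁻¹
  let g' := e ⟨g ^ N, hpow g⟩
  -- Conjugacy in `Γ` is coarser than in `Λ`, so one conjugate is needed for each coset.
  let h' (p : ι × (Γ ⧸ Λ)) := e ⟨p.2.out⁻¹ * h p.1 ^ N * p.2.out, hpow' _ _⟩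
  have hzpow {x : Γ} (hx : ¬ IsOfFinOrder x) : x ^ N ≠ 1 := fun h1 =>
    hx (isOfFinOrder_iff_pow_eq_one.2 ⟨N, hN, h1⟩)
  obtain ⟨K₀, φ₀, hK₀, h₁, t₀, n₀, hn₀, h₂⟩ := FreeGroup.exists_finiteIndex_character g' h'
    (fun h1 => hzpow hg (congrArg Subtype.val ((MulEquiv.map_eq_one_iff e).1 h1)))
    (fun p h1 => hzpow (hh p.1) (by
      have := congrArg Subtype.val ((MulEquiv.map_eq_one_iff e).1 h1)
      simp only [Subgroup.coe_one] at this
      rw [mul_assoc, inv_mul_eq_iff_eq_mul, mul_one, mul_eq_right] at this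
      exact this))
    (fun p m n hm hn hmn => by
      have hmn' := (Λ.subtype.comp e.symm.toMonoidHom).map_isConj hmn
      have e₁ : (Λ.subtype.comp e.symm.toMonoidHom) (g' ^ m) = g ^ (N * m) := by
        simp [g', zpow_mul]
      have e₂ : (Λ.subtype.comp e.symm.toMonoidHom) (h' p ^ n) =
          p.2.out⁻¹ * h p.1 ^ (N * n) * p.2.out⁻¹⁻¹ := by
        rw [zpow_mul, ← conj_zpow]
        simp [h']
      rw [e₁, e₂] at hmn'
      exact hne p.1 _ _ (mul_ne_zero hNZ hm) (mul_ne_zero hNZ hn)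
        (hmn'.trans (isConj_iff.2 ⟨p.2.out⁻¹, rfl⟩).symm))
  have hK₀' : (K₀.comap e.toMonoidHom).FiniteIndex :=
    ⟨by rw [Subgroup.index_comap_of_surjective _ e.surjective]; exact hK₀.index_ne_zero⟩
  set K₁ := (K₀.comap e.toMonoidHom).map Λ.subtype with hK₁
  have hK₁fin : K₁.FiniteIndex := by
    refine ⟨?_⟩
    rw [hK₁, Subgroup.index_map_subtype]
    exact mul_ne_zero hK₀'.index_ne_zero hfin.index_ne_zero
  have hmem₁ (x : Γ) : x ∈ K₁ ↔ ∃ hx : x ∈ Λ, e ⟨x, hx⟩ ∈ K₀ := by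
    simp [hK₁]
  have hmem (x : K₁.normalCore) : ∃ hx : x.1 ∈ Λ, e ⟨x, hx⟩ ∈ K₀ :=
    (hmem₁ _).1 (K₁.normalCore_le x.2)
  let φ : K₁.normalCore →* Multiplicative ℤ :=
    { toFun := fun x => φ₀ ⟨e ⟨x, (hmem x).1⟩, (hmem x).2⟩
      map_one' := by
        rw [← map_one φ₀]; congr 1; exact Subtype.ext (map_one e)
      map_mul' := fun x y => by
        rw [← map_mul φ₀]; congr 1
        exact Subtype.ext (map_mul e ⟨x, (hmem x).1⟩ ⟨y, (hmem y).1⟩) }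
  refine ⟨K₁.normalCore, φ, inferInstance, inferInstance, ?_, ?_⟩
  · intro i t k x hx
    set q : Γ ⧸ Λ := QuotientGroup.mk t⁻¹
    have hq : t * q.out ∈ Λ := by
      have : (QuotientGroup.mk t⁻¹ : Γ ⧸ Λ) = QuotientGroup.mk q.out := (Quotient.out_eq' q).symm
      simpa using QuotientGroup.eq.1 this
    -- As `t * q.out` lies in `Λ`, the `Γ`-conjugate becomes a `Λ`-conjugate of a power of `h' (i,
    -- q)`. Treating `x ^ N` is enough because `ℤ` is torsion-free.
    have hxN : e ⟨(x ^ N : K₁.normalCore), (hmem _).1⟩ =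
        e ⟨_, hq⟩ * h' (i, q) ^ k * (e ⟨_, hq⟩)⁻¹ := by
      simp only [h']
      rw [← map_zpow, ← map_inv, ← map_mul, ← map_mul]
      congr 1
      apply Subtype.ext
      have hc : q.out⁻¹ * h i ^ N * q.out = q.out⁻¹ * h i ^ N * q.out⁻¹⁻¹ := by rw [inv_inv]
      simp only [Subgroup.coe_pow, hx, Subgroup.coe_mul, Subgroup.coe_zpow, Subgroup.coe_inv]
      rw [hc, conj_zpow, conj_pow, ← zpow_natCast, ← zpow_natCast, zpow_comm]
      group
    have hφN : φ (x ^ N) = 1 := by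
      have hm := (hmem (x ^ N)).2
      have := h₁ (i, q) (e ⟨_, hq⟩) k (hxN ▸ hm)
      rw [← this]
      change φ₀ _ = φ₀ _
      congr 1
      exact Subtype.ext hxN
    rw [map_pow] at hφN
    have h0 : N • (φ x).toAdd = 0 := congrArg Multiplicative.toAdd hφN
    have := (smul_eq_zero.1 h0).resolve_left hN.ne'
    exact Multiplicative.toAdd.injective this
  · set s : Λ := e.symm t₀
    have hyΛ : s * g ^ (N * n₀) * (s : Γ)⁻¹ ∈ Λ :=
      hnor.conj_mem _ (by rw [pow_mul]; exact pow_mem (hpow g) _) _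
    have hval : e ⟨_, hyΛ⟩ = t₀ * g' ^ n₀ * t₀⁻¹ := by
      have hs : t₀ = e s := (e.apply_symm_apply t₀).symm
      simp only [g', hs]
      rw [← map_pow, ← map_inv, ← map_mul, ← map_mul]
      congr 1
      apply Subtype.ext
      simp [pow_mul]
    -- This power returns to the normal core, and torsion-freeness of `ℤ` keeps the value nonzero.
    set r := K₁.normalCore.index
    have hr : r ≠ 0 := Subgroup.FiniteIndex.index_ne_zero
    refine ⟨s, N * n₀ * r, ⟨_, Subgroup.pow_index_mem K₁.normalCore (s * g ^ (N * n₀) * (s : Γ)⁻¹)⟩,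
      by rw [pow_mul g (N * n₀)]; exact conj_pow, fun hφ => h₂ ?_⟩
    have hφr : φ₀ ⟨_, hn₀⟩ ^ r = 1 := by
      rw [← hφ, ← map_pow]
      change φ₀ _ = φ₀ _
      congr 1
      apply Subtype.ext
      simp only [Subgroup.coe_pow]
      rw [← hval, ← map_pow]
      rfl
    have h0 : r • (φ₀ ⟨_, hn₀⟩).toAdd = 0 := congrArg Multiplicative.toAdd hφr
    exact Multiplicative.toAdd.injective ((smul_eq_zero.1 h0).resolve_left hr)

/-! ### Prescribing orders in finite quotients. -/

/-- If a character of a finite-index normal subgroup detects a power of `g`, then the order of `g` in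
finite quotients can be prescribed up to a constant factor, while the elements whose powers are
ignored by the character keep bounded order. -/
theorem exists_quotient_orderOf {Γ : Type*} [Group Γ] {ι : Type*} (g : Γ) (h : ι → Γ)
    (K : Subgroup Γ) [K.Normal] [K.FiniteIndex] (φ : K →* Multiplicative ℤ)
    (hh : ∀ i t (k : ℤ) (x : K), (x : Γ) = t * h i ^ k * t⁻¹ → φ x = 1)
    (hg : ∃ (t : Γ) (n : ℕ) (x : K), (x : Γ) = t * g ^ n * t⁻¹ ∧ φ x ≠ 1) :
    ∃ k : ℕ, k ∣ K.index ∧ ∀ M : ℕ, 0 < M → ∃ N : Subgroup Γ, N.Normal ∧ N.FiniteIndex ∧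
      (∀ a : ℕ, g ^ a ∈ N ↔ k * M ∣ a) ∧ ∀ i, h i ^ K.index ∈ N := by
  set k := orderOf (QuotientGroup.mk' K g)
  have hk (a : ℕ) : g ^ a ∈ K ↔ k ∣ a := by
    rw [orderOf_dvd_iff_pow_eq_one, ← map_pow]
    exact (QuotientGroup.eq_one_iff _).symm
  have hconj (t : Γ) {x : Γ} (hx : x ∈ K) : t * x * t⁻¹ ∈ K := Subgroup.Normal.conj_mem ‹_› x hx t
  have hgk : g ^ k ∈ K := (hk k).2 dvd_rfl
  -- `φ` need not be invariant under conjugation by `Γ`, so all conjugates of `g ^ k` are tracked.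
  let C (t : Γ) : ℤ := (φ ⟨_, hconj t hgk⟩).toAdd
  have hC (t : Γ) (b : ℕ) (x : K) (hx : (x : Γ) = t * g ^ (k * b) * t⁻¹) :
      (φ x).toAdd = b * C t := by
    have : x = ⟨_, hconj t hgk⟩ ^ b := Subtype.ext (by simp [hx, pow_mul])
    rw [this, map_pow, toAdd_pow, nsmul_eq_mul]
  -- `c` is a gcd of the values `C t`: a modulus divides every `b * C t` exactly when it divides `b
  -- * c`. For the modulus `|c| * M` this means `M ∣ b`.
  obtain ⟨c, hc⟩ := Int.subgroup_cyclic (AddSubgroup.closure (Set.range C))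
  have hCc (t : Γ) : c ∣ C t := by
    have : C t ∈ AddSubgroup.closure {c} := hc ▸ AddSubgroup.subset_closure ⟨t, rfl⟩
    rw [← AddSubgroup.zmultiples_eq_closure, Int.mem_zmultiples_iff] at this
    exact this
  have hdvd (D : ℤ) (b : ℕ) (hD : ∀ t, D ∣ b * C t) : D ∣ b * c := by
    have hle : AddSubgroup.closure (Set.range C) ≤
        (AddSubgroup.zmultiples D).comap (AddMonoidHom.mulLeft (b : ℤ)) := by
      rw [AddSubgroup.closure_le]
      rintro _ ⟨t, rfl⟩
      exact Int.mem_zmultiples_iff.2 (hD t)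
    have := hle (hc ▸ AddSubgroup.subset_closure rfl : c ∈ AddSubgroup.closure (Set.range C))
    exact Int.mem_zmultiples_iff.1 this
  have hc0 : c ≠ 0 := by
    obtain ⟨t, n, x, hx, hφ⟩ := hg
    have hn : g ^ n ∈ K := by
      have := hconj t⁻¹ x.2
      rw [hx] at this
      simpa [mul_assoc] using this
    obtain ⟨b, rfl⟩ := (hk n).1 hn
    rintro rfl
    have h0 := hC t b x hx
    rw [zero_dvd_iff.1 (hCc t), mul_zero] at h0
    exact hφ (Multiplicative.toAdd.injective h0)
  refine ⟨k, ?_, fun M hM => ?_⟩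
  · rw [← hk]; exact Subgroup.pow_index_mem K g
  have hD0 : c.natAbs * M ≠ 0 := mul_ne_zero (Int.natAbs_ne_zero.2 hc0) hM.ne'
  set D := c.natAbs * M
  have : NeZero D := ⟨hD0⟩
  let ψ : K →* Multiplicative (ZMod D) := (Int.castAddHom (ZMod D)).toMultiplicative.comp φ
  have hψ (x : K) : x ∈ ψ.ker ↔ (D : ℤ) ∣ (φ x).toAdd := by
    rw [← ZMod.intCast_zmod_eq_zero_iff_dvd]; rfl
  have hfin : (ψ.ker.map K.subtype).FiniteIndex := by
    refine ⟨?_⟩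
    rw [Subgroup.index_map_subtype]
    exact mul_ne_zero (Subgroup.finiteIndex_ker ψ).index_ne_zero
      Subgroup.FiniteIndex.index_ne_zero
  have hmem (x : Γ) : x ∈ (ψ.ker.map K.subtype).normalCore ↔
      ∀ t, ∃ ht : t * x * t⁻¹ ∈ K, (D : ℤ) ∣ (φ ⟨_, ht⟩).toAdd := by
    change (∀ t, t * x * t⁻¹ ∈ ψ.ker.map K.subtype) ↔ _
    refine forall_congr' fun t => ?_
    rw [Subgroup.mem_map]
    constructor
    · rintro ⟨y, hy, hyx⟩
      have : y = ⟨t * x * t⁻¹, hyx ▸ y.2⟩ := Subtype.ext hyx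
      exact ⟨hyx ▸ y.2, this ▸ (hψ y).1 hy⟩
    · rintro ⟨ht, hd⟩
      exact ⟨⟨_, ht⟩, (hψ _).2 hd, rfl⟩
  refine ⟨(ψ.ker.map K.subtype).normalCore, inferInstance, inferInstance, fun a => ?_, fun i => ?_⟩
  · rw [hmem]
    constructor
    · intro hall
      obtain ⟨h1, -⟩ := hall 1
      rw [one_mul, inv_one, mul_one, hk] at h1
      obtain ⟨b, rfl⟩ := h1
      apply Nat.mul_dvd_mul_left
      have := hdvd D b fun t => by
        obtain ⟨ht, hd⟩ := hall t
        rwa [hC t b _ rfl] at hd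
      have := Int.natAbs_dvd_natAbs.2 this
      rw [Int.natAbs_mul, Int.natAbs_natCast, Int.natAbs_natCast, mul_comm] at this
      exact Nat.dvd_of_mul_dvd_mul_left (Int.natAbs_pos.2 hc0) this
    · rintro ⟨b, rfl⟩ t
      have hin : g ^ (k * M * b) ∈ K := (hk _).2 ⟨M * b, mul_assoc _ _ _⟩
      refine ⟨hconj t hin, ?_⟩
      rw [hC t (M * b) _ (by rw [← mul_assoc k])]
      have : (D : ℤ) ∣ M * C t := by
        rw [Nat.cast_mul, mul_comm]
        exact mul_dvd_mul_left _ (Int.natAbs_dvd.2 (hCc t))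
      push_cast
      rw [mul_right_comm]
      exact this.mul_right _
  · rw [hmem]
    intro t
    have hin : t * h i ^ K.index * t⁻¹ ∈ K := hconj t (Subgroup.pow_index_mem K _)
    refine ⟨hin, ?_⟩
    rw [hh i t K.index ⟨_, hin⟩ (by rw [zpow_natCast])]
    simp

/-! ### Combining the quotients. -/

theorem mainTheorem10 {Γ : Type*} [Group Γ] (hΓ : IsVirtuallyFree Γ)
    {m : ℕ} (γ : Fin m → Γ) (hγ : IsIndependentTuple γ) :
    ∃ κ : ℕ, 0 < κ ∧ ∀ e : Fin m → ℕ, (∀ i, 0 < e i) →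
      ∃ (Q : Type) (_ : Group Q) (_ : Finite Q) (q : Γ →* Q),
        (∀ i, orderOf (q (γ i)) = κ * e i) ∧
        ∀ i j, i ≠ j → Subgroup.zpowers (q (γ i)) ⊓ Subgroup.zpowers (q (γ j)) = ⊥ := by
  have hne (i j : Fin m) (hij : j ≠ i) (a b : ℤ) (ha : a ≠ 0) (hb : b ≠ 0) :
      ¬ IsConj (γ i ^ a) (γ j ^ b) := by
    rcases hij.lt_or_gt with h | h
    · exact fun hc => (hγ.2 j i h).2.2 b a hb ha hc.symm
    · exact (hγ.2 i j h).2.2 a b ha hb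
  have hexists (i : Fin m) : ∃ d k : ℕ, 0 < d ∧ k ∣ d ∧ ∀ M : ℕ, 0 < M →
      ∃ N : Subgroup Γ, N.Normal ∧ N.FiniteIndex ∧ (∀ a : ℕ, γ i ^ a ∈ N ↔ k * M ∣ a) ∧
        ∀ j, j ≠ i → γ j ^ d ∈ N := by
    obtain ⟨K, φ, _, hfin, h₁, h₂⟩ := hΓ.exists_normal_character (γ i)
      (fun j : {j // j ≠ i} => γ j) (hγ.1 i) (fun j => hγ.1 j)
      (fun j a b ha hb => hne i j j.2 a b ha hb)
    obtain ⟨k, hk, h⟩ := exists_quotient_orderOf (γ i) (fun j : {j // j ≠ i} => γ j) K φ h₁ h₂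
    refine ⟨K.index, k, Nat.pos_of_ne_zero hfin.index_ne_zero, hk, fun M hM => ?_⟩
    obtain ⟨N, hN, hNfin, h₃, h₄⟩ := h M hM
    exact ⟨N, hN, hNfin, h₃, fun j hj => h₄ ⟨j, hj⟩⟩
  choose d k hd hkd hN using hexists
  set D := ∏ i, d i
  have hD : 0 < D := Finset.prod_pos fun i _ => hd i
  have hdD (i) : d i ∣ D := Finset.dvd_prod_of_mem d (Finset.mem_univ i)
  -- The `D`-th power of `γ i` will lie in `N l` for `l ≠ i`; the second factor `D` absorbs the `d
  -- i` lost when powers of `γ i` and `γ j` are compared.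
  refine ⟨D * D, Nat.mul_pos hD hD, fun e he => ?_⟩
  have hk (i) : k i ∣ D * D * e i :=
    (((hkd i).trans (hdD i)).mul_right D).mul_right (e i)
  have hpos (i) : 0 < D * D * e i := Nat.mul_pos (Nat.mul_pos hD hD) (he i)
  choose N hnor hfin hself hother using fun i =>
    hN i (D * D * e i / k i) (Nat.div_pos (Nat.le_of_dvd (hpos i) (hk i))
      (Nat.pos_of_dvd_of_pos (hk i) (hpos i)))
  replace hself (i) (a : ℕ) : γ i ^ a ∈ N i ↔ D * D * e i ∣ a := by
    rw [hself, Nat.mul_div_cancel' (hk i)]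
  have hsmall (i l) (hil : i ≠ l) (a : ℕ) (ha : D ∣ a) : γ i ^ a ∈ N l := by
    obtain ⟨b, rfl⟩ := (hdD l).trans ha
    rw [pow_mul]
    exact pow_mem (hother l i hil) b
  have hnor' : (⨅ i, N i).Normal := Subgroup.normal_iInf_normal hnor
  have hfin' : (⨅ i, N i).FiniteIndex := Subgroup.finiteIndex_iInf hfin
  have : Finite (Γ ⧸ ⨅ i, N i) := Subgroup.finite_quotient_of_finiteIndex
  -- The quotient lives in the universe of `Γ`; being finite, it has a copy in `Type`.
  let q : Γ →* Shrink.{0} (Γ ⧸ ⨅ i, N i) :=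
    (Shrink.mulEquiv.{0} (α := Γ ⧸ ⨅ i, N i)).symm.toMonoidHom.comp (QuotientGroup.mk' (⨅ i, N i))
  have hq (x : Γ) : q x = 1 ↔ ∀ i, x ∈ N i := by
    rw [← Subgroup.mem_iInf, ← QuotientGroup.eq_one_iff]
    exact (Shrink.mulEquiv.{0} (α := Γ ⧸ ⨅ i, N i)).symm.map_eq_one_iff
  -- Raising to the power `d i` kills the `γ j` side modulo `N i`.
  have hdvd (i j) (hij : i ≠ j) (a b : ℕ) (hab : q (γ i ^ a) = q (γ j ^ b)) : D ∣ a := by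
    have h₁ : q (γ i ^ (a * d i) * (γ j ^ (b * d i))⁻¹) = 1 := by
      rw [map_mul, map_inv, pow_mul, pow_mul, map_pow q (γ i ^ a), map_pow q (γ j ^ b), hab,
        mul_inv_cancel]
    have h₂ : γ j ^ (b * d i) ∈ N i := by
      rw [mul_comm, pow_mul]
      exact pow_mem (hother i j hij.symm) b
    have h₃ : D * D * e i ∣ a * d i :=
      (hself i _).1 ((Subgroup.mul_mem_cancel_right _ (inv_mem h₂)).1 ((hq _).1 h₁ i))
    have h₄ : D * d i ∣ a * d i := ((mul_dvd_mul_left D (hdD i)).mul_right (e i)).trans h₃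
    exact Nat.dvd_of_mul_dvd_mul_right (hd i) h₄
  refine ⟨Shrink.{0} (Γ ⧸ ⨅ i, N i), inferInstance, inferInstance, q, fun i => ?_,
    fun i j hij => ?_⟩
  · have hord (a : ℕ) : orderOf (q (γ i)) ∣ a ↔ D * D * e i ∣ a := by
      rw [orderOf_dvd_iff_pow_eq_one, ← map_pow, hq, ← hself]
      refine ⟨fun h => h i, fun h l => ?_⟩
      by_cases hl : i = l
      · exact hl ▸ h
      · exact hsmall i l hl a (((dvd_mul_right D D).mul_right (e i)).trans ((hself i a).1 h))
    exact Nat.dvd_antisymm ((hord _).2 dvd_rfl) ((hord _).1 dvd_rfl)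
  · rw [eq_bot_iff]
    rintro x ⟨hx, hx'⟩
    obtain ⟨a, rfl⟩ := (isOfFinOrder_of_finite _).mem_powers_iff_mem_zpowers.2 hx
    obtain ⟨b, hb⟩ := (isOfFinOrder_of_finite _).mem_powers_iff_mem_zpowers.2 hx'
    simp only [← map_pow] at hb
    change q (γ i) ^ a = 1
    rw [← map_pow, hq]
    intro l
    -- Modulo `N i` the power of `γ j` dies because `D ∣ b`, and the equal power of `γ i` with it;
    -- modulo the other `N l`, `D ∣ a` suffices.
    by_cases hl : i = l
    · subst hl
      have h₁ : q (γ i ^ a * (γ j ^ b)⁻¹) = 1 := by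
        rw [map_mul, map_inv, hb, mul_inv_cancel]
      exact (Subgroup.mul_mem_cancel_right _
        (inv_mem (hsmall j i hij.symm b (hdvd j i hij.symm b a hb)))).1 ((hq _).1 h₁ i)
    · exact hsmall i l hl a (hdvd i j hij a b hb.symm)
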